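/- Fix a finite alphabet $\Sigma$ with at least one letter. A programming language $L$ over $\Sigma^*$ consists of an effectively coded set of programs, together with a semantics that determines, for each program $p$ and each input $x\in\Sigma^*$, whether $p$ terminates on $x$ and, if it does, its output in $\Sigma^*$ and its running time in $\mathbb N$. Suppose that $L$ is Turing complete and simulates Turing machines within polynomial overhead; that is, there is a computable translation $M\mapsto c(M)$ of (deterministic, multitape) Turing machines into $L$-programs such that (i) for every $M$ and every $x\in\Sigma^*$, $c(M)$ terminates on $x$ if and only if $M$ halts on $x$, and then with the same output; and (ii) for every $M$ there is a polynomial $q$ such that, whenever $M$ halts on $x$ after $t$ steps, the running time of $c(M)$ on $x$ is at most $q(|x|+t)$. Let $L^p$ be the set of the polynomial-time $L$-programs, that is, of the programs $p$ for which there is a polynomial $q$ such that $p$ terminates on every input $x\in\Sigma^*$ within time $q(|x|)$. Then $L^p$ is not semi-decidable (not recursively enumerable). -/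

import Mathlib

/-- A head movement: one cell to the left, none, or one cell to the right. -/
inductive Move where
  | left
  | stay
  | right

namespace Move

/-- Coding of head movements. -/
def equivOptionBool : Move ≃ Option Bool where
  toFun
    | left => some false
    | stay => none
    | right => some true
  invFun
    | some false => left
    | none => stay
    | some true => right
  left_inv a := by cases a <;> rfl
  right_inv a := by rcases a with _ | _ | _ <;> rfl

instance : Primcodable Move := Primcodable.ofEquiv _ equivOptionBool

/-- Move the head of a tape. -/
def apply {Γ : Type} [Inhabited Γ] : Move → Turing.Tape Γ → Turing.Tape Γ
  | left, T => T.move Turing.Dir.left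
  | stay, T => T
  | right, T => T.move Turing.Dir.right

end Move

/-- One instruction of a multitape Turing machine: in state `state`, when the symbols scanned on
the tapes `0, 1, …` are those of the list `read`, go to state `next`, and on the `i`-th tape write
the symbol and do the movement that form the `i`-th entry of `act` (a tape without entry is left
as it is). States and tape symbols are natural numbers. -/
structure TMRule where
  state : ℕ
  read : List ℕ
  next : ℕ
  act : List (ℕ × Move)

namespace TMRule

/-- Coding of instructions. -/
def equivProd : TMRule ≃ (ℕ × List ℕ) × (ℕ × List (ℕ × Move)) where
  toFun r := ((r.state, r.read), (r.next, r.act))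
  invFun p := ⟨p.1.1, p.1.2, p.2.1, p.2.2⟩
  left_inv _ := rfl
  right_inv _ := rfl

instance : Primcodable TMRule := Primcodable.ofEquiv _ equivProd

end TMRule

/-- A deterministic Turing machine with tapes `0, …, workTapes`, given by a finite list of
instructions (only the finitely many states and symbols that occur in the list matter; the first
applicable instruction is executed). The initial state is `0`, the blank symbol is `0`. -/
structure MultiTM where
  workTapes : ℕ
  rules : List TMRule

namespace MultiTM

/-- Coding of machines: the finite description of a machine as an effective datum. -/
def equivProd : MultiTM ≃ ℕ × List TMRule where
  toFun M := (M.workTapes, M.rules)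
  invFun p := ⟨p.1, p.2⟩
  left_inv _ := rfl
  right_inv _ := rfl

instance : Primcodable MultiTM := Primcodable.ofEquiv _ equivProd

/-- A configuration: the state, and the tapes with their head positions. -/
structure Cfg (M : MultiTM) where
  state : ℕ
  tapes : Fin (M.workTapes + 1) → Turing.Tape ℕ

/-- The list of scanned symbols. -/
def scanned (M : MultiTM) (c : M.Cfg) : List ℕ :=
  List.ofFn fun i => (c.tapes i).head

/-- Execute an instruction. -/
def exec (M : MultiTM) (r : TMRule) (c : M.Cfg) : M.Cfg where
  state := r.next
  tapes i :=
    match r.act[(i : ℕ)]? with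
    | some (s, d) => d.apply ((c.tapes i).write s)
    | none => c.tapes i

/-- One step of the computation; `none` when no instruction applies, i.e. the machine has
halted. -/
def step (M : MultiTM) (c : M.Cfg) : Option M.Cfg :=
  (M.rules.find? fun r => decide (r.state = c.state ∧ r.read = M.scanned c)).map
    fun r => M.exec r c

/-- The initial configuration on an input string over the alphabet with `m` letters: the `j`-th
letter is represented by the symbol `j + 1`, the input stands on tape `0` with the head on its
first letter, and all other tapes are blank. -/
def init (M : MultiTM) {m : ℕ} (x : List (Fin m)) : M.Cfg where
  state := 0
  tapes i := if (i : ℕ) = 0 then Turing.Tape.mk₁ (x.map fun a => (a : ℕ) + 1) else default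

end MultiTM

/-- The letter that is represented by a tape symbol, if any. -/
def symbolLetter (m : ℕ) : ℕ → Option (Fin m)
  | 0 => none
  | s + 1 => if h : s < m then some ⟨s, h⟩ else none

/-- The longest initial segment of a list of symbols that consists of letters. -/
def readLetters (m : ℕ) : List ℕ → List (Fin m)
  | [] => []
  | s :: l =>
    match symbolLetter m s with
    | none => []
    | some a => a :: readLetters m l

theorem readLetters_append_blank (m : ℕ) (l : List ℕ) (n : ℕ) :
    readLetters m (l ++ List.replicate n 0) = readLetters m l := by
  induction l with
  | nil => cases n <;> simp [readLetters, List.replicate_succ, symbolLetter]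
  | cons s l ih =>
    simp only [List.cons_append, readLetters]
    cases symbolLetter m s <;> simp [ih]

/-- The string written on a tape from the head to the right, up to the first symbol that is
not a letter. -/
def tapeString (m : ℕ) (T : Turing.Tape ℕ) : List (Fin m) :=
  T.right₀.liftOn (readLetters m) (by
    rintro l _ ⟨n, rfl⟩
    exact (readLetters_append_blank m l n).symm)

namespace MultiTM

/-- `M.HaltsWith x y t`: on input `x`, the machine halts after exactly `t` steps with output `y`,
the string at the head of the last tape. -/
def HaltsWith (M : MultiTM) {m : ℕ} (x y : List (Fin m)) (t : ℕ) : Prop :=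
  ∃ c : M.Cfg, (fun o : Option M.Cfg => o.bind M.step)^[t] (some (M.init x)) = some c ∧
    M.step c = none ∧ tapeString m (c.tapes (Fin.last M.workTapes)) = y

end MultiTM

/-- A (deterministic) programming language on strings over the alphabet with `m` letters, with
programs `P`, given by its semantics: `run p x` is undefined if the program `p` does not terminate
on the input `x`, and otherwise it is the pair of the output and the running time. No relation
between the running times of different programs, and no effectiveness of `run`, is imposed. -/
structure ProgLang (m : ℕ) (P : Type*) where
  run : P → List (Fin m) →. List (Fin m) × ℕ

namespace ProgLang

variable {m : ℕ} {P : Type*}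

/-- `c` translates each Turing machine into a program that computes the same partial function. -/
def IsTranslation (L : ProgLang m P) (c : MultiTM → P) : Prop :=
  ∀ (M : MultiTM) (x y : List (Fin m)),
    (∃ t, (y, t) ∈ L.run (c M) x) ↔ ∃ t, M.HaltsWith x y t

/-- The translation has polynomial overhead: for each machine `M` the running time of its
translation is at most a polynomial in the input length and the running time of `M`. -/
def HasPolyOverhead (L : ProgLang m P) (c : MultiTM → P) : Prop :=
  ∀ M : MultiTM, ∃ q : Polynomial ℕ, ∀ (x y y' : List (Fin m)) (t t' : ℕ),
    M.HaltsWith x y t → (y', t') ∈ L.run (c M) x → t' ≤ q.eval (x.length + t)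

/-- The language is Turing complete, simulating Turing machines within polynomial overhead:
Turing machines can be effectively translated into programs that compute the same partial
function, with polynomial overhead. -/
def SimulatesTMsInPTime [Primcodable P] (L : ProgLang m P) : Prop :=
  ∃ c : MultiTM → P, Computable c ∧ L.IsTranslation c ∧ L.HasPolyOverhead c

/-- The set of the polynomial-time programs: those that terminate on every input within a
number of steps that is bounded by a polynomial in the length of the input. -/
def ptimePrograms (L : ProgLang m P) : Set P :=
  {p | ∃ q : Polynomial ℕ, ∀ x : List (Fin m), ∃ y t, (y, t) ∈ L.run p x ∧ t ≤ q.eval x.length}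

end ProgLang

/-!
Polynomial-time programs cannot be recognised for a logical reason that has little to do with
running times: the complement of the halting problem reduces to membership in `L.ptimePrograms`.

For a partial recursive `f` and an argument `n`, consider the machine that uses its input `x` only
as a clock. It simulates the computation of `f n` on its work tape, consuming one letter of `x` in
each step; if the input is exhausted first, it halts, and if the simulated computation ends first,
it loops. If `f n` is undefined, this machine halts on every `x` after exactly `x.length` steps, so
that its translation is a polynomial-time program. If `f n` is defined, the machine does not halt on
long enough inputs, hence its translation is not total. Since only an upper bound for the running
time of translated programs is needed in the first case, and none in the second, nothing has to be
known about the running times in `L` beyond polynomial overhead. Long inputs exist as the alphabet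
is not empty.

The machine that does this for a given transition table is `MultiTM.clocked`; its two behaviours are
`MultiTM.haltsWith_clocked` and `MultiTM.not_haltsWith_clocked`. The simulated machine is obtained
from Mathlib's chain of simulations `ToPartrec.Code → TM2 → TM1 → TM0` (`exists_tm0_dom_iff`). It is
one and the same machine for all `n`. Only the states of a loader that writes the initial work tape
depend on `n`, which makes the reduction evidently computable; see `exists_computable_clocked`.
-/

/-! ### Machines with the input as a clock -/

/-- `TableRun tab k q T`: started in state `0` on a blank tape, the one-tape machine with transition
table `tab` is after `k` steps in state `q` with tape `T`. An entry `((q, a), (q', b, d))` of the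
table means: in state `q` with scanned symbol `a`, go to state `q'`, write `b` and do the
movement `d`. -/
inductive TableRun (tab : List ((ℕ × ℕ) × (ℕ × ℕ × Move))) : ℕ → ℕ → Turing.Tape ℕ → Prop
  | start : TableRun tab 0 0 default
  | step {k q T q' b d} : TableRun tab k q T → ((q, T.head), (q', b, d)) ∈ tab →
      TableRun tab (k + 1) q' (d.apply (T.write b))

namespace MultiTM

/-- The two-tape machine that executes the transition table `tab` on its work tape as long as
there is input left: each step consumes an input letter. In the situations (state and scanned work
symbol) listed in `hs`, which are meant to be without entry in `tab`, it stays in the same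
configuration forever, both before and at the end of the input. -/
def clocked (m : ℕ) (tab : List ((ℕ × ℕ) × (ℕ × ℕ × Move))) (hs : List (ℕ × ℕ)) : MultiTM where
  workTapes := 1
  rules :=
    (tab.flatMap fun e => (List.range m).map fun s =>
      ⟨e.1.1, [s + 1, e.1.2], e.2.1, [(s + 1, Move.right), (e.2.2.1, e.2.2.2)]⟩) ++
    (hs.flatMap fun h => (List.range (m + 1)).map fun s => ⟨h.1, [s, h.2], h.1, []⟩)

theorem primrec_clocked (m : ℕ) (hs : List (ℕ × ℕ)) : Primrec fun tab => clocked m tab hs := by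
  have hmk : Primrec fun p : (ℕ × List ℕ) × (ℕ × List (ℕ × Move)) =>
      (⟨p.1.1, p.1.2, p.2.1, p.2.2⟩ : TMRule) := Primrec.of_equiv_symm (e := TMRule.equivProd)
  have hM : Primrec fun p : ℕ × List TMRule => (⟨p.1, p.2⟩ : MultiTM) :=
    Primrec.of_equiv_symm (e := MultiTM.equivProd)
  refine hM.comp ((Primrec.const 1).pair
    (Primrec.list_append.comp (Primrec.list_flatMap Primrec.id ?_) (Primrec.const _)))
  refine Primrec.list_map (Primrec.const _) (g := fun (e : List ((ℕ × ℕ) × (ℕ × ℕ × Move)) ×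
    ((ℕ × ℕ) × (ℕ × ℕ × Move))) s => (⟨e.2.1.1, [s + 1, e.2.1.2], e.2.2.1,
      [(s + 1, Move.right), (e.2.2.2.1, e.2.2.2.2)]⟩ : TMRule)) ?_
  have he : Primrec fun p : (List ((ℕ × ℕ) × (ℕ × ℕ × Move)) × ((ℕ × ℕ) × (ℕ × ℕ × Move))) × ℕ =>
    p.1.2 := Primrec.snd.comp Primrec.fst
  have hk := Primrec.fst.comp he
  have hv := Primrec.snd.comp he
  have hs' := Primrec.succ.comp (Primrec.snd (α := List ((ℕ × ℕ) × (ℕ × ℕ × Move)) ×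
    ((ℕ × ℕ) × (ℕ × ℕ × Move))) (β := ℕ))
  exact hmk.comp (((Primrec.fst.comp hk).pair
    (Primrec.list_cons.comp hs' (Primrec.list_cons.comp (Primrec.snd.comp hk)
      (Primrec.const [])))).pair ((Primrec.fst.comp hv).pair
    (Primrec.list_cons.comp (hs'.pair (Primrec.const Move.right))
      (Primrec.list_cons.comp (Primrec.snd.comp hv) (Primrec.const [])))))

/-- The tape with the input `x`, the head being `k` cells to the right of the first letter. -/
def inputTape {m : ℕ} (x : List (Fin m)) (k : ℕ) : Turing.Tape ℕ :=
  (Turing.Tape.move Turing.Dir.right)^[k] (Turing.Tape.mk₁ (x.map fun a : Fin m => (a : ℕ) + 1))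

theorem inputTape_succ {m : ℕ} (x : List (Fin m)) (k : ℕ) :
    inputTape x (k + 1) = (inputTape x k).move Turing.Dir.right :=
  Function.iterate_succ_apply' _ _ _

theorem inputTape_head {m : ℕ} (x : List (Fin m)) (k : ℕ) :
    (inputTape x k).head = (x.map fun a : Fin m => (a : ℕ) + 1).getI k := by
  rw [inputTape, Turing.Tape.move_right_n_head]
  exact Turing.Tape.mk'_nth_nat _ _ _

theorem inputTape_head_of_lt {m : ℕ} {x : List (Fin m)} {k : ℕ} (hk : k < x.length) :
    ∃ s < m, (inputTape x k).head = s + 1 := by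
  refine ⟨x[k], x[k].2, ?_⟩
  rw [inputTape_head, List.getI_eq_getElem _ (by simpa using hk), List.getElem_map]

theorem inputTape_head_length {m : ℕ} (x : List (Fin m)) : (inputTape x x.length).head = 0 := by
  rw [inputTape_head, List.getI_eq_default _ (by simp)]
  rfl

section

variable {m : ℕ} {tab : List ((ℕ × ℕ) × (ℕ × ℕ × Move))} {hs : List (ℕ × ℕ)}

/-- The configuration of the clocked machine after `k` letters of the input `x` have been
consumed, with state `q` and work tape `T`. -/
def clockedCfg (m : ℕ) (tab : List ((ℕ × ℕ) × (ℕ × ℕ × Move))) (hs : List (ℕ × ℕ))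
    (x : List (Fin m)) (k q : ℕ) (T : Turing.Tape ℕ) : (clocked m tab hs).Cfg where
  state := q
  tapes i := if (i : ℕ) = 0 then inputTape x k else T

theorem init_clocked (x : List (Fin m)) :
    (clocked m tab hs).init x = clockedCfg m tab hs x 0 0 default := by
  -- In `MultiTM.init` the coercion to `ℕ` is lifted to the list `x`, as a monadic bind.
  have hx : (x.flatMap fun a : Fin m => [(a : ℕ)]) = x.map fun a : Fin m => (a : ℕ) :=
    List.flatMap_pure_eq_map _ _
  simp [init, clockedCfg, inputTape, hx, Function.comp_def]

theorem scanned_clockedCfg (x : List (Fin m)) (k q : ℕ) (T : Turing.Tape ℕ) :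
    (clocked m tab hs).scanned (clockedCfg m tab hs x k q T) = [(inputTape x k).head, T.head] :=
  rfl

theorem mem_rules_clocked {r : TMRule} : r ∈ (clocked m tab hs).rules ↔
    (∃ e ∈ tab, ∃ s < m,
      ⟨e.1.1, [s + 1, e.1.2], e.2.1, [(s + 1, Move.right), (e.2.2.1, e.2.2.2)]⟩ = r) ∨
    ∃ h ∈ hs, ∃ s < m + 1, ⟨h.1, [s, h.2], h.1, []⟩ = r := by
  simp only [clocked, List.mem_append, List.mem_flatMap, List.mem_map, List.mem_range]

/-- If all applicable instructions agree with `r`, then `r` is executed. -/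
theorem step_eq_of_forall {M : MultiTM} {c : M.Cfg} {r : TMRule} (hr : r ∈ M.rules)
    (hstate : r.state = c.state) (hread : r.read = M.scanned c)
    (huniq : ∀ r' ∈ M.rules, r'.state = c.state → r'.read = M.scanned c → r' = r) :
    M.step c = some (M.exec r c) := by
  unfold step
  cases h : M.rules.find? fun r => decide (r.state = c.state ∧ r.read = M.scanned c) with
  | none => exact absurd (List.find?_eq_none.1 h r hr) (by simp [hstate, hread])
  | some r' =>
    have h1 := List.find?_some h
    simp only [decide_eq_true_eq] at h1
    rw [huniq r' (List.mem_of_find?_eq_some h) h1.1 h1.2]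
    rfl

theorem step_clockedCfg_of_mem (hfun : ∀ a v v', (a, v) ∈ tab → (a, v') ∈ tab → v = v')
    (hdisj : ∀ a v, (a, v) ∈ tab → a ∉ hs) {x : List (Fin m)} {k : ℕ} (hk : k < x.length)
    {q q' b : ℕ} {d : Move} {T : Turing.Tape ℕ} (h : ((q, T.head), (q', b, d)) ∈ tab) :
    (clocked m tab hs).step (clockedCfg m tab hs x k q T) =
      some (clockedCfg m tab hs x (k + 1) q' (d.apply (T.write b))) := by
  obtain ⟨s, hs', hx⟩ := inputTape_head_of_lt hk
  rw [step_eq_of_forall (r := ⟨q, [s + 1, T.head], q', [(s + 1, Move.right), (b, d)]⟩)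
    (mem_rules_clocked.2 (.inl ⟨_, h, s, hs', rfl⟩)) rfl (by rw [scanned_clockedCfg, hx])]
  · congr 1
    simp only [exec, clockedCfg, Cfg.mk.injEq, true_and]
    funext i
    obtain ⟨i, hi⟩ := i
    have hi' : i < 2 := hi
    interval_cases i
    · simp only [List.getElem?_cons_zero, if_true, Move.apply]
      rw [← hx, Turing.Tape.write_self, inputTape_succ]
    · simp
  · intro r hr h1 h2
    rw [scanned_clockedCfg, hx] at h2
    rcases mem_rules_clocked.1 hr with ⟨⟨⟨q₁, a₁⟩, v⟩, he, s', _, rfl⟩ | ⟨⟨q₁, a₁⟩, he, s', _, rfl⟩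
    · obtain rfl : q₁ = q := h1
      simp only [List.cons.injEq, Nat.add_right_cancel_iff, and_true] at h2
      obtain ⟨rfl, rfl⟩ := h2
      obtain rfl := hfun _ _ _ he h
      rfl
    · obtain rfl : q₁ = q := h1
      simp only [List.cons.injEq, and_true] at h2
      obtain ⟨rfl, rfl⟩ := h2
      exact absurd he (hdisj _ _ h)

theorem step_clockedCfg_of_halting (hdisj : ∀ a v, (a, v) ∈ tab → a ∉ hs) {x : List (Fin m)}
    {k : ℕ} {q : ℕ} {T : Turing.Tape ℕ} (hk : k ≤ x.length) (h : (q, T.head) ∈ hs) :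
    (clocked m tab hs).step (clockedCfg m tab hs x k q T) = some (clockedCfg m tab hs x k q T) := by
  have hx : (inputTape x k).head < m + 1 := by
    rcases hk.lt_or_eq with hk | rfl
    · obtain ⟨s, hs', hx⟩ := inputTape_head_of_lt hk
      omega
    · rw [inputTape_head_length]
      omega
  rw [step_eq_of_forall (r := ⟨q, [(inputTape x k).head, T.head], q, []⟩)
    (mem_rules_clocked.2 (.inr ⟨_, h, _, hx, rfl⟩)) rfl (by rw [scanned_clockedCfg])]
  · rfl
  · intro r hr h1 h2
    rw [scanned_clockedCfg] at h2
    rcases mem_rules_clocked.1 hr with ⟨⟨⟨q₁, a₁⟩, v⟩, he, s', _, rfl⟩ | ⟨⟨q₁, a₁⟩, he, s', _, rfl⟩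
    · obtain rfl : q₁ = q := h1
      simp only [List.cons.injEq, and_true] at h2
      obtain ⟨_, rfl⟩ := h2
      exact absurd h (hdisj _ _ he)
    · obtain rfl : q₁ = q := h1
      simp only [List.cons.injEq, and_true] at h2
      obtain ⟨rfl, rfl⟩ := h2
      rfl

theorem step_clockedCfg_length {x : List (Fin m)} {q : ℕ} {T : Turing.Tape ℕ}
    (h : (q, T.head) ∉ hs) :
    (clocked m tab hs).step (clockedCfg m tab hs x x.length q T) = none := by
  rw [step, Option.map_eq_none_iff, List.find?_eq_none]
  intro r hr
  rw [decide_eq_true_eq, scanned_clockedCfg, inputTape_head_length]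
  rintro ⟨h1, h2⟩
  rcases mem_rules_clocked.1 hr with ⟨⟨⟨q₁, a₁⟩, v⟩, he, s', _, rfl⟩ | ⟨⟨q₁, a₁⟩, he, s', _, rfl⟩
  · simp at h2
  · obtain rfl : q₁ = q := h1
    simp only [List.cons.injEq, and_true] at h2
    obtain ⟨_, rfl⟩ := h2
    exact h he

/-- The clocked machine runs in lockstep with its table while the input lasts. -/
theorem iterate_step_clocked (hfun : ∀ a v v', (a, v) ∈ tab → (a, v') ∈ tab → v = v')
    (hdisj : ∀ a v, (a, v) ∈ tab → a ∉ hs) {x : List (Fin m)} {k q : ℕ} {T : Turing.Tape ℕ}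
    (h : TableRun tab k q T) (hk : k ≤ x.length) :
    (fun o : Option (clocked m tab hs).Cfg => o.bind (clocked m tab hs).step)^[k]
      (some ((clocked m tab hs).init x)) = some (clockedCfg m tab hs x k q T) := by
  induction h with
  | start => exact congrArg some (init_clocked x)
  | step _ hmem ih =>
    rw [Function.iterate_succ_apply', ih (by omega)]
    exact step_clockedCfg_of_mem hfun hdisj (by omega) hmem

theorem haltsWith_clocked (hfun : ∀ a v v', (a, v) ∈ tab → (a, v') ∈ tab → v = v')
    (hdisj : ∀ a v, (a, v) ∈ tab → a ∉ hs) {x : List (Fin m)} {q : ℕ} {T : Turing.Tape ℕ}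
    (h : TableRun tab x.length q T) (hq : (q, T.head) ∉ hs) :
    ∃ y, (clocked m tab hs).HaltsWith x y x.length :=
  ⟨_, _, iterate_step_clocked hfun hdisj h le_rfl, step_clockedCfg_length hq, rfl⟩

theorem not_haltsWith_clocked (hfun : ∀ a v v', (a, v) ∈ tab → (a, v') ∈ tab → v = v')
    (hdisj : ∀ a v, (a, v) ∈ tab → a ∉ hs) {x y : List (Fin m)} {t q : ℕ} {T : Turing.Tape ℕ}
    (h : TableRun tab x.length q T) (hq : (q, T.head) ∈ hs) :
    ¬ (clocked m tab hs).HaltsWith x y t := by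
  rintro ⟨c, hc, hstep, -⟩
  have hloop := step_clockedCfg_of_halting hdisj (le_refl x.length) hq
  have hlen := iterate_step_clocked hfun hdisj h le_rfl
  have hafter : ∀ j, (fun o : Option (clocked m tab hs).Cfg => o.bind (clocked m tab hs).step)^[j]
      (some (clockedCfg m tab hs x x.length q T)) = some (clockedCfg m tab hs x x.length q T) :=
    fun j => Function.iterate_fixed hloop j
  generalize clockedCfg m tab hs x x.length q T = c₀ at hloop hlen hafter
  have hnone : ∀ j, (fun o : Option (clocked m tab hs).Cfg => o.bind (clocked m tab hs).step)^[j]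
      none = none := fun j => Function.iterate_fixed rfl j
  rcases le_total t x.length with hle | hle
  · -- Halting before the end of the input contradicts the run up to there, unless `t = x.length`.
    obtain ⟨j, hj⟩ := Nat.exists_eq_add_of_le' hle
    rw [hj, Function.iterate_add_apply, hc] at hlen
    rcases j with _ | j
    · obtain rfl := Option.some.inj hlen
      rw [hloop] at hstep
      cases hstep
    · rw [Function.iterate_succ_apply, Option.bind_some, hstep, hnone] at hlen
      cases hlen
  · obtain ⟨j, rfl⟩ := Nat.exists_eq_add_of_le' hle
    rw [Function.iterate_add_apply, hlen, hafter] at hc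
    obtain rfl := Option.some.inj hc
    rw [hloop] at hstep
    cases hstep

end

end MultiTM

/-! ### Partial recursive functions on a `TM0` machine -/

open Turing PartrecToTM2 in
theorem trNat_two_pow (n : ℕ) : trNat (2 ^ n) = List.replicate n Γ'.bit0 ++ [Γ'.bit1] := by
  have h : ((2 ^ n : ℕ) : Num) = Num.pos (PosNum.bit0^[n] PosNum.one) := by
    induction n with
    | zero => rfl
    | succ n ih =>
      rw [pow_succ, mul_two, Nat.cast_add, ih, Function.iterate_succ_apply', Num.bit0_of_bit0]
      rfl
  rw [trNat, h, trNum]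
  clear h
  induction n with
  | zero => rfl
  | succ n ih => rw [Function.iterate_succ_apply', trPosNum, ih]; rfl

open Turing PartrecToTM2 in
/-- The domain of a partial recursive function is the halting set of a Turing machine with finitely
many symbols and states. The argument `n` is fed to Mathlib's machine for partial recursive
functions as the number `2 ^ n`, whose binary notation has an evident shape, so that the input tape
is visibly computable from `n`. -/
theorem exists_tm0_dom_iff {f : ℕ →. ℕ} (hf : Partrec f) :
    ∃ (Γ Λ : Type) (_ : Inhabited Γ) (_ : Fintype Γ) (_ : Inhabited Λ) (M : TM0.Machine Γ Λ)
      (S : Finset Λ) (a b c : Γ), TM0.Supports M (S : Set Λ) ∧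
      ∀ n, (TM0.eval M (a :: b :: List.replicate n c)).Dom ↔ (f n).Dom := by
  -- The argument `n` of `f` is recovered from `2 ^ n` by bounded search.
  have hg : Partrec fun N : ℕ => f (N.findGreatest fun k => 2 ^ k = N) := by
    refine hf.comp (Primrec.to_comp (Primrec.nat_findGreatest (f := fun N => N)
      (p := fun N k => 2 ^ k = N) Primrec.id ?_))
    have hpow : Primrec fun k : ℕ => 2 ^ k := by
      refine (Primrec.nat_rec₁ (f := fun _ p => p * 2) 1 (Primrec.nat_mul.comp Primrec.snd
        (Primrec.const 2)).to₂).of_eq fun n => ?_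
      induction n with
      | zero => rfl
      | succ n ih => simp [ih, pow_succ]
    exact Primrec.eq.comp (hpow.comp Primrec.snd) Primrec.fst
  have hfind : ∀ n, ((2 ^ n).findGreatest fun k => 2 ^ k = 2 ^ n) = n := fun n =>
    Nat.pow_right_injective le_rfl
      (Nat.findGreatest_spec (P := fun k => 2 ^ k = 2 ^ n) Nat.lt_two_pow_self.le rfl)
  obtain ⟨c, hc⟩ := ToPartrec.Code.exists_code (Nat.Partrec'.part_iff₁.2 hg)
  let M : Λ' → TM2.Stmt (fun _ : K' => Γ') Λ' (Option Γ') := tr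
  let : Inhabited Λ' := ⟨trNormal c .halt⟩
  have : Fintype K' := ⟨{.main, .rev, .aux, .stack}, fun k => by cases k <;> simp⟩
  -- The tape symbol that stands for the entry `s` of the main stack, the other stacks being empty.
  let cell : Γ' → TM2to1.Γ' K' (fun _ => Γ') := fun s =>
    (false, Function.update (fun _ => none) .main (some s))
  refine ⟨TM2to1.Γ' K' (fun _ => Γ'), TM1to0.Λ' (TM2to1.tr M), inferInstance, inferInstance,
    inferInstance, TM1to0.tr (TM2to1.tr M), _, (true, (cell .cons).2), cell .bit1, cell .bit0,
    TM1to0.tr_supports _ (TM2to1.tr_supports _ (tr_supports c .halt)), fun n => ?_⟩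
  have hinput : (true, (cell .cons).2) :: cell .bit1 :: List.replicate n (cell .bit0) =
      TM2to1.trInit K'.main (trList [2 ^ n]) := by
    have hrev : (trList [2 ^ n]).reverse = Γ'.cons :: Γ'.bit1 :: List.replicate n Γ'.bit0 := by
      simp [trNat_two_pow]
    rw [TM2to1.trInit, hrev, ← List.map_replicate]
    rfl
  have hinit : TM2.init K'.main (trList [2 ^ n]) = PartrecToTM2.init c [2 ^ n] := by
    simp only [TM2.init, PartrecToTM2.init]
    congr 1
    funext k
    cases k <;> rfl
  have hTM0 := congrArg Part.Dom
    (TM1to0.tr_eval (TM2to1.tr M) (TM2to1.trInit K'.main (trList [2 ^ n])))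
  have hTM1 := TM2to1.tr_eval_dom M K'.main (trList [2 ^ n])
  have hTM2 : (TM2.eval M K'.main (trList [2 ^ n])).Dom ↔ (f n).Dom := by
    change (StateTransition.eval (TM2.step tr) (TM2.init K'.main (trList [2 ^ n]))).Dom ↔ _
    rw [hinit, PartrecToTM2.tr_eval, show c.eval [2 ^ n] = _ from hc ⟨[2 ^ n], rfl⟩]
    change (f ((2 ^ n).findGreatest fun k => 2 ^ k = 2 ^ n)).Dom ↔ _
    rw [hfind]
  exact (iff_of_eq ((congrArg (fun l => (TM0.eval (TM1to0.tr (TM2to1.tr M)) l).Dom) hinput).trans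
    hTM0)).trans (hTM1.trans hTM2)

/-! ### Writing the initial work tape -/

section

open Turing

/-- Table entries that write the word `w` from right to left on a blank tape, using the states
`0, 2, …, 2 * w.length`, put the head on the last symbol written, and go to state `q₀`. -/
def loaderTable (q₀ : ℕ) (w : List ℕ) : List ((ℕ × ℕ) × (ℕ × ℕ × Move)) :=
  ((List.range w.length).map fun j => ((2 * j, 0), (2 * (j + 1), w.getI j, Move.left))) ++
    [((2 * w.length, 0), (q₀, 0, Move.right))]

theorem primrec_loaderTable (q₀ : ℕ) : Primrec (loaderTable q₀) := by
  have hdouble : Primrec fun j : ℕ => 2 * j := Primrec.nat_mul.comp (Primrec.const 2) Primrec.id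
  refine Primrec.list_append.comp
    (Primrec.list_map (Primrec.list_range.comp Primrec.list_length) ?_)
    (Primrec.list_cons.comp (((hdouble.comp Primrec.list_length).pair (Primrec.const 0)).pair
      (Primrec.const _)) (Primrec.const []))
  exact ((hdouble.comp Primrec.snd).pair (Primrec.const 0)).pair
    ((hdouble.comp (Primrec.succ.comp Primrec.snd)).pair
      ((Primrec.list_getI.comp Primrec.fst Primrec.snd).pair (Primrec.const Move.left)))

theorem mem_loaderTable {q₀ : ℕ} {w : List ℕ} {e : (ℕ × ℕ) × (ℕ × ℕ × Move)} :
    e ∈ loaderTable q₀ w ↔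
      (∃ j < w.length, ((2 * j, 0), (2 * (j + 1), w.getI j, Move.left)) = e) ∨
      e = ((2 * w.length, 0), (q₀, 0, Move.right)) := by
  simp [loaderTable]

theorem move_right_mk₁_blank_cons (l : List ℕ) :
    (Tape.mk₁ (0 :: l)).move Dir.right = Tape.mk₁ l := by
  change (Tape.mk' _ _).move _ = Tape.mk' _ _
  rw [Tape.move_right_mk', ListBlank.head_mk, ListBlank.tail_mk]
  congr 1
  exact Quotient.sound' (.inr ⟨1, rfl⟩)

theorem move_left_mk₁ (l : List ℕ) : (Tape.mk₁ l).move Dir.left = Tape.mk₁ (0 :: l) := by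
  rw [← move_right_mk₁_blank_cons l, Tape.move_right_left]

theorem write_mk₁_cons (a b : ℕ) (l : List ℕ) :
    (Tape.mk₁ (a :: l)).write b = Tape.mk₁ (b :: l) := by
  change (Tape.mk' _ _).write _ = Tape.mk' _ _
  rw [Tape.write_mk', ListBlank.tail_mk, ListBlank.cons_mk, List.tail_cons]

theorem default_tape_eq : (default : Tape ℕ) = Tape.mk₁ [0] := by
  change Tape.mk' _ (ListBlank.mk []) = Tape.mk' _ (ListBlank.mk [0])
  congr 1
  exact Quotient.sound' (.inl ⟨1, rfl⟩)

variable {tab : List ((ℕ × ℕ) × (ℕ × ℕ × Move))} {q₀ : ℕ} {w : List ℕ}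

theorem tableRun_loader (h : loaderTable q₀ w ⊆ tab) {j : ℕ} (hj : j ≤ w.length) :
    TableRun tab j (2 * j) (Tape.mk₁ (0 :: (w.take j).reverse)) := by
  induction j with
  | zero =>
    have := TableRun.start (tab := tab)
    rwa [default_tape_eq] at this
  | succ j ih =>
    have := (ih (by omega)).step (h (mem_loaderTable.2 (.inl ⟨j, hj, rfl⟩)))
    rwa [write_mk₁_cons, Move.apply, move_left_mk₁, List.getI_eq_getElem _ hj,
      ← List.reverse_concat', List.take_concat_get'] at this

theorem tableRun_loader_end (h : loaderTable q₀ w ⊆ tab) :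
    TableRun tab (w.length + 1) q₀ (Tape.mk₁ w.reverse) := by
  have := (tableRun_loader h le_rfl).step (h (mem_loaderTable.2 (.inr rfl)))
  rwa [write_mk₁_cons, Move.apply, move_right_mk₁_blank_cons, List.take_length] at this

end

/-! ### The transition table of a `TM0` machine -/

section

open Turing

/-- Rendering of a `TM0` statement, given the scanned symbol: the symbol to write and the
movement. -/
def actionOfStmt {Γ : Type} (e : Γ → ℕ) (a : Γ) : TM0.Stmt Γ → ℕ × Move
  | .move .left => (e a, .left)
  | .move .right => (e a, .right)
  | .write b => (e b, .stay)

theorem apply_actionOfStmt {Γ : Type} [Inhabited Γ] (E : PointedMap Γ ℕ) (T : Tape Γ)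
    (s : TM0.Stmt Γ) :
    (actionOfStmt E T.head s).2.apply ((T.map E).write (actionOfStmt E T.head s).1) =
      Tape.map E (match s with
        | .move d => T.move d
        | .write b => T.write b) := by
  rcases s with (_ | _) | b
  · simp only [actionOfStmt, Move.apply]
    rw [← Tape.map_fst, Tape.write_self, Tape.map_move]
  · simp only [actionOfStmt, Move.apply]
    rw [← Tape.map_fst, Tape.write_self, Tape.map_move]
  · simp only [actionOfStmt, Move.apply, Tape.map_write]

variable {Γ Λ : Type} [Fintype Γ] [Inhabited Λ]

/-- The transition table of a `TM0` machine restricted to the states in `S`. The numbering `st` of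
states is turned into one by odd numbers. -/
noncomputable def tm0Table (M : TM0.Machine Γ Λ) (S : Finset Λ) (st : Λ → ℕ) (e : Γ → ℕ) :
    List ((ℕ × ℕ) × (ℕ × ℕ × Move)) :=
  (S ×ˢ (Finset.univ : Finset Γ)).toList.filterMap fun p =>
    (M p.1 p.2).map fun r => ((2 * st p.1 + 1, e p.2), (2 * st r.1 + 1, actionOfStmt e p.2 r.2))

open Classical in
/-- The state-symbol pairs in which a `TM0` machine halts, numbered as in `tm0Table`. -/
noncomputable def tm0Halts (M : TM0.Machine Γ Λ) (S : Finset Λ) (st : Λ → ℕ) (e : Γ → ℕ) :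
    List (ℕ × ℕ) :=
  ((S ×ˢ (Finset.univ : Finset Γ)).filter fun p => M p.1 p.2 = none).toList.map fun p =>
    (2 * st p.1 + 1, e p.2)

variable {M : TM0.Machine Γ Λ} {S : Finset Λ} {st : Λ → ℕ}

theorem mem_tm0Table {e : Γ → ℕ} {x : (ℕ × ℕ) × (ℕ × ℕ × Move)} :
    x ∈ tm0Table M S st e ↔ ∃ q ∈ S, ∃ a q' s, M q a = some (q', s) ∧
      ((2 * st q + 1, e a), (2 * st q' + 1, actionOfStmt e a s)) = x := by
  simp [tm0Table]

theorem mem_tm0Halts {e : Γ → ℕ} {x : ℕ × ℕ} :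
    x ∈ tm0Halts M S st e ↔ ∃ q ∈ S, ∃ a, M q a = none ∧ (2 * st q + 1, e a) = x := by
  simp [tm0Halts, and_assoc]

/-- The odd states belong to the machine and the even ones to the loader, so that the joint table is
deterministic. -/
theorem loader_append_tm0Table_functional {e : Γ → ℕ} (hst : Set.InjOn st S)
    (he : Function.Injective e) (q₀ : ℕ) (w : List ℕ) (k : ℕ × ℕ) (v v' : ℕ × ℕ × Move)
    (h : (k, v) ∈ loaderTable q₀ w ++ tm0Table M S st e)
    (h' : (k, v') ∈ loaderTable q₀ w ++ tm0Table M S st e) : v = v' := by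
  simp only [List.mem_append, mem_loaderTable, mem_tm0Table, Prod.mk.injEq] at h h'
  rcases h with (⟨j, hj, rfl, rfl⟩ | ⟨rfl, rfl⟩) | ⟨q, hq, a, q₁, s, hM, rfl, rfl⟩ <;>
  rcases h' with (⟨j', hj', hk, rfl⟩ | ⟨hk, rfl⟩) | ⟨q', hq', a', q₁', s', hM', hk, rfl⟩ <;>
  rw [Prod.mk.injEq] at hk
  · obtain rfl : j = j' := by omega
    rfl
  · omega
  · omega
  · omega
  · omega
  · omega
  · omega
  · obtain rfl := hst hq' hq (by omega)
    obtain rfl := he hk.2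
    rw [hM, Option.some.injEq, Prod.mk.injEq] at hM'
    rw [hM'.1, hM'.2]

theorem notMem_tm0Halts_of_mem {e : Γ → ℕ} (hst : Set.InjOn st S) (he : Function.Injective e)
    (q₀ : ℕ) (w : List ℕ) (k : ℕ × ℕ) (v : ℕ × ℕ × Move)
    (h : (k, v) ∈ loaderTable q₀ w ++ tm0Table M S st e) : k ∉ tm0Halts M S st e := by
  intro h'
  obtain ⟨q', hq', a', hM', rfl⟩ := mem_tm0Halts.1 h'
  simp only [List.mem_append, mem_loaderTable, mem_tm0Table, Prod.mk.injEq] at h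
  rcases h with (⟨j, hj, hk, rfl⟩ | ⟨hk, rfl⟩) | ⟨q, hq, a, q₁, s, hM, hk, rfl⟩
  · omega
  · omega
  · obtain rfl := hst hq' hq (by omega)
    obtain rfl := he hk.2
    rw [hM'] at hM
    cases hM

theorem tableRun_tm0 [Inhabited Γ] (hS : TM0.Supports M (S : Set Λ)) {E : PointedMap Γ ℕ}
    {tab : List ((ℕ × ℕ) × (ℕ × ℕ × Move))} (h : tm0Table M S st E ⊆ tab) {l : List Γ} {k : ℕ}
    (hk : TableRun tab k (2 * st default + 1) (Tape.mk₁ (l.map E))) {t : ℕ} {c : TM0.Cfg Γ Λ}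
    (hc : (fun o : Option (TM0.Cfg Γ Λ) => o.bind (TM0.step M))^[t] (some (TM0.init l)) =
      some c) :
    c.q ∈ S ∧ TableRun tab (k + t) (2 * st c.q + 1) (c.Tape.map E) := by
  induction t generalizing c with
  | zero =>
    obtain rfl := Option.some.inj hc
    refine ⟨hS.1, ?_⟩
    simpa only [TM0.init, Tape.map_mk₁, add_zero] using hk
  | succ t ih =>
    rw [Function.iterate_succ_apply', Option.bind_eq_some_iff] at hc
    obtain ⟨⟨q, T⟩, hc', hstep⟩ := hc
    obtain ⟨hq, hrun⟩ := ih hc'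
    refine ⟨TM0.step_supports M hS hstep hq, ?_⟩
    obtain ⟨⟨q', s⟩, hM, rfl⟩ := Option.map_eq_some_iff.1 hstep
    have := hrun.step (h (mem_tm0Table.2 ⟨q, hq, T.head, q', s, hM,
      Prod.ext (Prod.ext rfl (Tape.map_fst E T).symm) rfl⟩))
    exact apply_actionOfStmt E T s ▸ this

end

/-! ### Counting the steps of an evaluation -/

section

variable {σ : Type*} {f : σ → Option σ} {a : σ}

theorem exists_iterate_of_eval_dom (h : (StateTransition.eval f a).Dom) :
    ∃ t b, (fun o : Option σ => o.bind f)^[t] (some a) = some b ∧ f b = none := by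
  obtain ⟨hreach, hb⟩ := StateTransition.mem_eval.1 (Part.get_mem h)
  suffices ∀ b, StateTransition.Reaches f a b →
      ∃ t, (fun o : Option σ => o.bind f)^[t] (some a) = some b by
    obtain ⟨t, ht⟩ := this _ hreach
    exact ⟨t, _, ht, hb⟩
  intro b hab
  induction hab with
  | refl => exact ⟨0, rfl⟩
  | tail _ hbc ih =>
    obtain ⟨t, ht⟩ := ih
    exact ⟨t + 1, by rw [Function.iterate_succ_apply', ht]; exact hbc⟩

theorem exists_iterate_of_not_eval_dom (h : ¬ (StateTransition.eval f a).Dom) (t : ℕ) :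
    ∃ b c, (fun o : Option σ => o.bind f)^[t] (some a) = some b ∧ f b = some c := by
  suffices ∃ b, StateTransition.Reaches f a b ∧
      (fun o : Option σ => o.bind f)^[t] (some a) = some b by
    obtain ⟨b, hab, ht⟩ := this
    cases hb : f b with
    | none => exact absurd (Part.dom_iff_mem.2 ⟨b, StateTransition.mem_eval.2 ⟨hab, hb⟩⟩) h
    | some c => exact ⟨b, c, ht, hb⟩
  induction t with
  | zero => exact ⟨a, .refl, rfl⟩
  | succ t ih =>
    obtain ⟨b, hab, ht⟩ := ih
    cases hb : f b with
    | none => exact absurd (Part.dom_iff_mem.2 ⟨b, StateTransition.mem_eval.2 ⟨hab, hb⟩⟩) h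
    | some c =>
      exact ⟨c, hab.tail hb, by rw [Function.iterate_succ_apply', ht]; exact hb⟩

end

/-! ### The reduction -/

/-- The complement of the domain of `f` reduces to totality in real time: `F n` reads its input once
from left to right while simulating the computation of `f n`, and loops if the simulation ends
before the input does. -/
theorem exists_computable_clocked {m : ℕ} (hm : 1 ≤ m) {f : ℕ →. ℕ} (hf : Partrec f) :
    ∃ F : ℕ → MultiTM, Computable F ∧ ∀ n,
      (¬ (f n).Dom → ∀ x : List (Fin m), ∃ y, (F n).HaltsWith x y x.length) ∧
      ((f n).Dom → ∃ x : List (Fin m), ∀ y t, ¬ (F n).HaltsWith x y t) := by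
  classical
  obtain ⟨Γ, Λ, _, _, _, M, S, a, b, c, hS, hM⟩ := exists_tm0_dom_iff hf
  obtain ⟨st, hst⟩ := Set.countable_iff_exists_injOn.1 S.countable_toSet
  -- A numbering of the symbols with the blank numbered `0`.
  let E : Turing.PointedMap Γ ℕ :=
    ⟨fun s => if s = default then 0 else Fintype.equivFin Γ s + 1, if_pos rfl⟩
  have hE : Function.Injective E := by
    intro s s' h
    change (if _ then _ else _) = (if _ then _ else _) at h
    split_ifs at h with h1 h2 h2
    · rw [h1, h2]
    · exact (Fintype.equivFin Γ).injective (Fin.ext (Nat.succ_injective h))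
  let w : ℕ → List ℕ := fun n => (List.range n).map (fun _ => E c) ++ [E b, E a]
  have hw : ∀ n, (w n).reverse = (a :: b :: List.replicate n c).map E := fun n => by
    simp [w, List.map_const']
  have hwprim : Primrec w := Primrec.list_append.comp
    (Primrec.list_map Primrec.list_range (Primrec.const _)) (Primrec.const _)
  let q₀ := 2 * st default + 1
  let tab : ℕ → List ((ℕ × ℕ) × (ℕ × ℕ × Move)) := fun n =>
    loaderTable q₀ (w n) ++ tm0Table M S st E
  have hload : ∀ n, loaderTable q₀ (w n) ⊆ tab n := fun n => List.subset_append_left _ _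
  have hsim : ∀ n, tm0Table M S st E ⊆ tab n := fun n => List.subset_append_right _ _
  have hstart : ∀ n, TableRun (tab n) ((w n).length + 1) q₀
      (Turing.Tape.mk₁ ((a :: b :: List.replicate n c).map E)) := fun n => by
    rw [← hw]
    exact tableRun_loader_end (hload n)
  have hfun := fun n => loader_append_tm0Table_functional (M := M) hst hE q₀ (w n)
  have hdisj := fun n => notMem_tm0Halts_of_mem (M := M) hst hE q₀ (w n)
  refine ⟨fun n => MultiTM.clocked m (tab n) (tm0Halts M S st E),
    ((MultiTM.primrec_clocked m _).comp (Primrec.list_append.comp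
      ((primrec_loaderTable q₀).comp hwprim) (Primrec.const _))).to_comp, fun n => ⟨?_, ?_⟩⟩
  · intro hn x
    rcases le_or_gt x.length (w n).length with hx | hx
    · refine MultiTM.haltsWith_clocked (hfun n) (hdisj n) (tableRun_loader (hload n) hx) ?_
      intro hmem
      obtain ⟨q, -, s, -, hq⟩ := mem_tm0Halts.1 hmem
      rw [Prod.mk.injEq] at hq
      omega
    · obtain ⟨t, ht⟩ := Nat.exists_eq_add_of_le (Nat.succ_le_of_lt hx)
      obtain ⟨c₁, c₂, hc₁, hstep⟩ := exists_iterate_of_not_eval_dom (f := Turing.TM0.step M)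
        (a := Turing.TM0.init (a :: b :: List.replicate n c)) (fun h => hn ((hM n).1 h)) t
      obtain ⟨hq, hrun⟩ := tableRun_tm0 hS (hsim n) (hstart n) hc₁
      rw [← Nat.succ_eq_add_one, ← ht] at hrun
      refine MultiTM.haltsWith_clocked (hfun n) (hdisj n) hrun ?_
      intro hmem
      obtain ⟨q, hqS, s, hnone, hqs⟩ := mem_tm0Halts.1 hmem
      rw [Prod.mk.injEq, Turing.Tape.map_fst] at hqs
      obtain rfl := hst hqS hq (by omega)
      obtain rfl := hE hqs.2
      obtain ⟨_, hsome, -⟩ := Option.map_eq_some_iff.1 hstep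
      rw [hnone] at hsome
      cases hsome
  · intro hn
    obtain ⟨t, c₁, hc₁, hstep⟩ := exists_iterate_of_eval_dom (f := Turing.TM0.step M)
      (a := Turing.TM0.init (a :: b :: List.replicate n c)) ((hM n).2 hn)
    obtain ⟨hq, hrun⟩ := tableRun_tm0 hS (hsim n) (hstart n) hc₁
    -- The input is just long enough for the simulation to reach the end of the computation.
    refine ⟨List.replicate ((w n).length + 1 + t) ⟨0, hm⟩, fun y t' => ?_⟩
    rw [← List.length_replicate (n := (w n).length + 1 + t) (a := (⟨0, hm⟩ : Fin m))] at hrun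
    refine MultiTM.not_haltsWith_clocked (hfun n) (hdisj n) hrun (mem_tm0Halts.2
      ⟨c₁.q, hq, c₁.Tape.head, Option.map_eq_none_iff.1 hstep, ?_⟩)
    rw [Turing.Tape.map_fst]

theorem theorem1 {m : ℕ} (hm : 1 ≤ m) {P : Type*} [Primcodable P] (L : ProgLang m P)
    (hL : L.SimulatesTMsInPTime) :
    ¬ REPred (fun p : P => p ∈ L.ptimePrograms) := by
  intro hre
  obtain ⟨c, hc, htrans, hpoly⟩ := hL
  have hf : Partrec fun n : ℕ => Nat.Partrec.Code.eval (Denumerable.ofNat Nat.Partrec.Code n) 0 :=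
    Nat.Partrec.Code.eval_part.comp (Computable.ofNat _) (Computable.const 0)
  obtain ⟨F, hF, hdom⟩ := exists_computable_clocked hm hf
  have hiff : ∀ d : Nat.Partrec.Code,
      c (F (Encodable.encode d)) ∈ L.ptimePrograms ↔ ¬ (d.eval 0).Dom := by
    intro d
    have hd := hdom (Encodable.encode d)
    rw [Denumerable.ofNat_encode] at hd
    constructor
    · rintro ⟨q, hq⟩ hn
      obtain ⟨x, hx⟩ := hd.2 hn
      obtain ⟨y, t, hrun, -⟩ := hq x
      obtain ⟨t', ht'⟩ := (htrans _ x y).1 ⟨t, hrun⟩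
      exact hx y t' ht'
    · intro hn
      obtain ⟨q, hq⟩ := hpoly (F (Encodable.encode d))
      -- The machine halts after `x.length` steps, and `q` is evaluated at `x.length + x.length`.
      refine ⟨q.comp (Polynomial.C 2 * Polynomial.X), fun x => ?_⟩
      obtain ⟨y, hy⟩ := hd.1 hn x
      obtain ⟨t, ht⟩ := (htrans _ x y).2 ⟨_, hy⟩
      refine ⟨y, t, ht, (hq x y y _ t hy ht).trans_eq ?_⟩
      rw [Polynomial.eval_comp, Polynomial.eval_mul, Polynomial.eval_C, Polynomial.eval_X, two_mul]
  refine ComputablePred.halting_problem_not_re 0 (REPred.of_eq ?_ hiff)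
  exact Partrec.comp hre (hc.comp (hF.comp Computable.encode))
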